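/- Throughout, a ring is an abelian group with an associative multiplication satisfying both distributive laws; it need not be commutative, have an identity, or be finite. For a ring $R$, let $\eta_\ell(R)$, $\eta_r(R)$ and $\eta(R)$ denote the minimal number of proper left, right, and two-sided ideals of $R$, respectively, whose union equals $R$ (and $\infty$ if no such finite cover exists). Let $\mathcal{M}_2(\mathbb{Z}_m)$ be the ring of $2\times 2$ matrices over the integers modulo $m$. Let $X$ be the subring $$X=\left\{\begin{pmatrix}0&0\\0&0\end{pmatrix},\begin{pmatrix}2&0\\0&0\end{pmatrix},\begin{pmatrix}0&0\\0&2\end{pmatrix},\begin{pmatrix}2&0\\0&2\end{pmatrix}\right\}$$ of $\mathcal{M}_2(\mathbb{Z}_4)$ (in which all products are zero), and let $Y$ and $Z$ be the subrings of $\mathcal{M}_2(\mathbb{Z}_2)$ given by $$Y=\left\{\begin{pmatrix}0&0\\0&0\end{pmatrix},\begin{pmatrix}1&0\\0&0\end{pmatrix},\begin{pmatrix}0&1\\0&0\end{pmatrix},\begin{pmatrix}1&1\\0&0\end{pmatrix}\right\},\qquad Z=\left\{\begin{pmatrix}0&0\\0&0\end{pmatrix},\begin{pmatrix}0&1\\0&0\end{pmatrix},\begin{pmatrix}0&0\\0&1\end{pmatrix},\begin{pmatrix}0&1\\0&1\end{pmatrix}\right\}.$$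 Then for every ring $R$: (1) $\eta(R)=3$ if and only if $R$ has a factor ring isomorphic to $X$; (2) $\eta_\ell(R)=3$ if and only if $R$ has a factor ring isomorphic to $X$ or to $Y$; (3) $\eta_r(R)=3$ if and only if $R$ has a factor ring isomorphic to $X$ or to $Z$. -/

import Mathlib

namespace IdealCover

section Ideals

variable {R : Type*} [NonUnitalRing R]

/-- An additive subgroup of a (possibly non-unital) ring is a left ideal if it is closed under
left multiplication by elements of the ring. -/
def IsLeftIdeal (I : AddSubgroup R) : Prop := ∀ r x : R, x ∈ I → r * x ∈ I

/-- An additive subgroup of a (possibly non-unital) ring is a right ideal if it is closed under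
right multiplication by elements of the ring. -/
def IsRightIdeal (I : AddSubgroup R) : Prop := ∀ r x : R, x ∈ I → x * r ∈ I

/-- A two-sided ideal is an additive subgroup that is both a left and a right ideal. -/
def IsTwoSidedIdeal (I : AddSubgroup R) : Prop := IsLeftIdeal I ∧ IsRightIdeal I

/-- The least number of proper additive subgroups satisfying `P` whose union is all of `R`;
it is `⊤` if there is no such (finite) family. -/
noncomputable def coveringNumber (P : AddSubgroup R → Prop) : ℕ∞ :=
  sInf {n : ℕ∞ | ∃ C : Set (AddSubgroup R),
    (∀ I ∈ C, P I ∧ I ≠ ⊤) ∧ (⋃ I ∈ C, (I : Set R)) = Set.univ ∧ C.encard = n}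

end Ideals

/-- The left ideal covering number of a ring. -/
noncomputable def etaLeft (R : Type*) [NonUnitalRing R] : ℕ∞ :=
  coveringNumber (IsLeftIdeal (R := R))

/-- The right ideal covering number of a ring. -/
noncomputable def etaRight (R : Type*) [NonUnitalRing R] : ℕ∞ :=
  coveringNumber (IsRightIdeal (R := R))

/-- The (two-sided) ideal covering number of a ring. -/
noncomputable def eta (R : Type*) [NonUnitalRing R] : ℕ∞ :=
  coveringNumber (IsTwoSidedIdeal (R := R))

/-- `R` has a factor ring `R / I`, with `I` a two-sided ideal, that is isomorphic to `S`. -/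
def HasFactorRing (R S : Type*) [NonUnitalRing R] [NonUnitalRing S] : Prop :=
  ∃ I : TwoSidedIdeal R, Nonempty (I.ringCon.Quotient ≃+* S)

/-- The ring `X`, a subring of the `2 × 2` matrices over `ℤ/4`. -/
def ringX : NonUnitalSubring (Matrix (Fin 2) (Fin 2) (ZMod 4)) where
  carrier := {!![0, 0; 0, 0], !![2, 0; 0, 0], !![0, 0; 0, 2], !![2, 0; 0, 2]}
  zero_mem' := by left; decide
  add_mem' := by
    rintro a b (rfl | rfl | rfl | rfl) (rfl | rfl | rfl | rfl) <;>
      simp only [Set.mem_insert_iff, Set.mem_singleton_iff] <;> decide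
  neg_mem' := by
    rintro a (rfl | rfl | rfl | rfl) <;>
      simp only [Set.mem_insert_iff, Set.mem_singleton_iff] <;> decide
  mul_mem' := by
    rintro a b (rfl | rfl | rfl | rfl) (rfl | rfl | rfl | rfl) <;>
      simp only [Set.mem_insert_iff, Set.mem_singleton_iff] <;> decide

/-- The ring `Y`, a subring of the `2 × 2` matrices over `ℤ/2`. -/
def ringY : NonUnitalSubring (Matrix (Fin 2) (Fin 2) (ZMod 2)) where
  carrier := {!![0, 0; 0, 0], !![1, 0; 0, 0], !![0, 1; 0, 0], !![1, 1; 0, 0]}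
  zero_mem' := by left; decide
  add_mem' := by
    rintro a b (rfl | rfl | rfl | rfl) (rfl | rfl | rfl | rfl) <;>
      simp only [Set.mem_insert_iff, Set.mem_singleton_iff] <;> decide
  neg_mem' := by
    rintro a (rfl | rfl | rfl | rfl) <;>
      simp only [Set.mem_insert_iff, Set.mem_singleton_iff] <;> decide
  mul_mem' := by
    rintro a b (rfl | rfl | rfl | rfl) (rfl | rfl | rfl | rfl) <;>
      simp only [Set.mem_insert_iff, Set.mem_singleton_iff] <;> decide

/-- The ring `Z`, a subring of the `2 × 2` matrices over `ℤ/2`. -/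
def ringZ : NonUnitalSubring (Matrix (Fin 2) (Fin 2) (ZMod 2)) where
  carrier := {!![0, 0; 0, 0], !![0, 1; 0, 0], !![0, 0; 0, 1], !![0, 1; 0, 1]}
  zero_mem' := by left; decide
  add_mem' := by
    rintro a b (rfl | rfl | rfl | rfl) (rfl | rfl | rfl | rfl) <;>
      simp only [Set.mem_insert_iff, Set.mem_singleton_iff] <;> decide
  neg_mem' := by
    rintro a (rfl | rfl | rfl | rfl) <;>
      simp only [Set.mem_insert_iff, Set.mem_singleton_iff] <;> decide
  mul_mem' := by
    rintro a b (rfl | rfl | rfl | rfl) (rfl | rfl | rfl | rfl) <;>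
      simp only [Set.mem_insert_iff, Set.mem_singleton_iff] <;> decide

end IdealCover

/-! A group is never the union of two proper subgroups. If three proper subgroups cover it, each has
index two and contains the intersection of the other two, so they are the kernels of `α`, `β` and `α
+ β` for independent characters to `ZMod 2` (`coveringNumber_eq_three_iff`).

If these kernels are left ideals, each `x` acts on `R ⧸ (ker α ⊓ ker β)`, a plane over the field of
two elements, preserving all three lines, hence as a scalar `l x`, and `l` is multiplicative
(`exists_scalar_of_isLeftIdeal`). If `l = 0`, all products die in the plane, which is then `ringX`.
If `l ≠ 0`, then `l` and one of `α`, `β` are coordinates of a quotient with the multiplication of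
`ringY`. For two-sided ideals, right stability forces `l = 0`; the right-handed case is the
left-handed one in the opposite ring. -/

namespace IdealCover

/-! ### Coverings of an abelian group by three subgroups -/

section Groups

variable {G : Type*} [AddCommGroup G]

/-- Two additive characters with values in `ZMod 2` are independent if `(α, β)` is onto. -/
def Independent (α β : G →+ ZMod 2) : Prop :=
  (∃ v, α v = 1 ∧ β v = 0) ∧ ∃ w, α w = 0 ∧ β w = 1

theorem Independent.exists_eq {α β : G →+ ZMod 2} (h : Independent α β) (s t : ZMod 2) :
    ∃ x, α x = s ∧ β x = t := by
  obtain ⟨⟨v, hv, hv'⟩, w, hw, hw'⟩ := h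
  have key : ∀ s : ZMod 2, s = 0 ∨ s = 1 := by decide
  rcases key s with rfl | rfl <;> rcases key t with rfl | rfl
  · exact ⟨0, by simp⟩
  · exact ⟨w, hw, hw'⟩
  · exact ⟨v, hv, hv'⟩
  · exact ⟨v + w, by simp [*]⟩

/-- The only scalars are 0 and 1, so distinct nonzero characters are linearly independent. -/
theorem independent_of_ne {α β : G →+ ZMod 2} (hα : α ≠ 0) (hβ : β ≠ 0) (h : α ≠ β) :
    Independent α β := by
  have key : ∀ s : ZMod 2, s = 0 ∨ s = 1 := by decide
  have two : (1 : ZMod 2) + 1 = 0 := by decide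
  obtain ⟨x, hx⟩ := DFunLike.ne_iff.1 hα
  obtain ⟨y, hy⟩ := DFunLike.ne_iff.1 hβ
  obtain ⟨z, hz⟩ := DFunLike.ne_iff.1 h
  have hx1 := (key (α x)).resolve_left hx
  have hy1 := (key (β y)).resolve_left hy
  rcases key (α z) with h1 | h1 <;> rcases key (β z) with h2 | h2
  · exact absurd (h1.trans h2.symm) hz
  · refine ⟨?_, z, h1, h2⟩
    rcases key (β x) with h3 | h3
    · exact ⟨x, hx1, h3⟩
    · exact ⟨x + z, by simp [*]⟩
  · refine ⟨⟨z, h1, h2⟩, ?_⟩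
    rcases key (α y) with h3 | h3
    · exact ⟨y, h3, hy1⟩
    · exact ⟨y + z, by simp [*]⟩
  · exact absurd (h1.trans h2.symm) hz

/-- A group is not the union of two proper subgroups. -/
theorem exists_notMem_notMem {A B : AddSubgroup G} (hA : A ≠ ⊤) (hB : B ≠ ⊤) :
    ∃ x, x ∉ A ∧ x ∉ B := by
  obtain ⟨a, ha⟩ : ∃ a, a ∉ A := by simpa [AddSubgroup.eq_top_iff'] using hA
  obtain ⟨b, hb⟩ : ∃ b, b ∉ B := by simpa [AddSubgroup.eq_top_iff'] using hB
  by_contra! h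
  have haB := h a ha
  have hbA : b ∈ A := by by_contra hb'; exact hb (h b hb')
  have hab : a + b ∉ A := fun h' => ha ((A.add_mem_cancel_right hbA).1 h')
  exact hb ((B.add_mem_cancel_left haB).1 (h _ hab))

theorem three_le_encard_of_cover {C : Set (AddSubgroup G)} (hC : ∀ I ∈ C, I ≠ ⊤)
    (hU : (⋃ I ∈ C, (I : Set G)) = Set.univ) : 3 ≤ C.encard := by
  have hmem : ∀ x : G, ∃ I ∈ C, x ∈ I := fun x => by
    have : x ∈ ⋃ I ∈ C, (I : Set G) := hU ▸ Set.mem_univ x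
    simpa using this
  by_contra! h
  obtain ⟨A, hA, -⟩ := hmem 0
  by_cases hB : ∃ B ∈ C, B ≠ A
  · obtain ⟨B, hB, hne⟩ := hB
    have hsub : ({A, B} : Set (AddSubgroup G)) ⊆ C := by
      rintro I (rfl | rfl) <;> assumption
    have h2 : C.encard ≤ 2 := Order.le_of_lt_succ h
    have heq : ({A, B} : Set (AddSubgroup G)) = C :=
      (Set.toFinite _).eq_of_subset_of_encard_le hsub (by rwa [Set.encard_pair hne.symm])
    obtain ⟨x, hxA, hxB⟩ := exists_notMem_notMem (hC A hA) (hC B hB)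
    obtain ⟨I, hI, hx⟩ := hmem x
    rw [← heq] at hI
    rcases hI with rfl | rfl <;> contradiction
  · push Not at hB
    refine hC A hA ((AddSubgroup.eq_top_iff' A).2 fun x => ?_)
    obtain ⟨I, hI, hx⟩ := hmem x
    exact hB I hI ▸ hx

/-- If a group is the union of three distinct proper subgroups, the intersection of any two of
them is contained in the third. -/
theorem mem_of_mem_of_mem_of_cover {A B C : AddSubgroup G} (hA : A ≠ ⊤) (hB : B ≠ ⊤)
    (hU : ∀ x, x ∈ A ∨ x ∈ B ∨ x ∈ C) {x : G} (hxA : x ∈ A) (hxB : x ∈ B) : x ∈ C := by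
  obtain ⟨c, hcA, hcB⟩ := exists_notMem_notMem hA hB
  have hc : c ∈ C := ((hU c).resolve_left hcA).resolve_left hcB
  -- Translating by `x ∈ A ⊓ B` keeps `c` outside both `A` and `B`.
  have hxc : x + c ∈ C := by
    refine ((hU _).resolve_left fun h => hcA ?_).resolve_left fun h => hcB ?_
    · exact (A.add_mem_cancel_left hxA).1 h
    · exact (B.add_mem_cancel_left hxB).1 h
  exact (C.add_mem_cancel_right hc).1 hxc

/-- An element of `B` only plus an element of `C` only lies in neither `B` nor `C`, hence in `A`. So
all elements outside `A` fall in one coset, that of `b`. -/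
theorem index_eq_two_of_cover {A B C : AddSubgroup G} (hA : A ≠ ⊤) (hB : B ≠ ⊤) (hC : C ≠ ⊤)
    (hU : ∀ x, x ∈ A ∨ x ∈ B ∨ x ∈ C) : A.index = 2 := by
  obtain ⟨b, hbA, hbC⟩ := exists_notMem_notMem hA hC
  obtain ⟨c, hcA, hcB⟩ := exists_notMem_notMem hA hB
  have hbB : b ∈ B := ((hU b).resolve_left hbA).resolve_right hbC
  have hcC : c ∈ C := ((hU c).resolve_left hcA).resolve_left hcB
  have hBC : ∀ {x}, x ∈ B → x ∈ C → x ∈ A := fun {x} h h' =>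
    mem_of_mem_of_mem_of_cover hB hC (fun y => by have := hU y; tauto) h h'
  have add_mem_of : ∀ {x y}, x ∈ B → x ∉ C → y ∈ C → y ∉ B → x + y ∈ A := by
    intro x y hx hx' hy hy'
    refine (hU _).resolve_right ?_
    rintro (h | h)
    · exact hy' ((B.add_mem_cancel_left hx).1 h)
    · exact hx' ((C.add_mem_cancel_right hy).1 h)
  have hbc : b + c ∈ A := add_mem_of hbB hbC hcC hcB
  have hbc' : b + -c ∈ A := add_mem_of hbB hbC (C.neg_mem hcC) (by simpa using hcB)
  refine AddSubgroup.index_eq_two_iff.2 ⟨b, fun x => ?_⟩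
  by_cases hx : x ∈ A
  · exact Or.inr ⟨hx, fun h => hbA ((A.add_mem_cancel_left hx).1 h)⟩
  refine Or.inl ⟨?_, hx⟩
  rcases (hU x).resolve_left hx with hxB | hxC
  · have hxc : x + c ∈ A := add_mem_of hxB (fun h => hx (hBC hxB h)) hcC hcB
    have := A.add_mem hxc hbc'
    rwa [show x + c + (b + -c) = x + b by abel] at this
  · have := add_mem_of hbB hbC hxC (fun h => hx (hBC h hxC))
    rwa [add_comm] at this

/-- The additive character with kernel a given subgroup of index two. -/
theorem exists_character_of_index_eq_two {A : AddSubgroup G} (hA : A.index = 2) :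
    ∃ α : G →+ ZMod 2, ∀ x, α x = 0 ↔ x ∈ A := by
  classical
  refine ⟨{ toFun := fun x => if x ∈ A then 0 else 1, map_zero' := by simp, map_add' := ?_ },
    fun x => ?_⟩
  swap
  · change (if x ∈ A then (0 : ZMod 2) else 1) = 0 ↔ x ∈ A
    by_cases h : x ∈ A <;> simp [h]
  intro x y
  have := AddSubgroup.add_mem_iff_of_index_two hA (a := x) (b := y)
  have two : (1 : ZMod 2) + 1 = 0 := by decide
  by_cases hx : x ∈ A <;> by_cases hy : y ∈ A <;> simp [this, hx, hy, two]

theorem Independent.cover {α β : G →+ ZMod 2} (x : G) :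
    x ∈ α.ker ∨ x ∈ β.ker ∨ x ∈ (α + β).ker := by
  have key : ∀ s t : ZMod 2, s = 0 ∨ t = 0 ∨ s + t = 0 := by decide
  exact key _ _

end Groups

/-! ### Ideal covers in terms of characters -/

section Characters

variable {R : Type*} [NonUnitalRing R]

/-- A covering number equals three exactly if the ring is the union of the kernels of `α`, `β` and
`α + β` for independent characters `α` and `β`. -/
theorem coveringNumber_eq_three_iff (P : AddSubgroup R → Prop) :
    coveringNumber P = 3 ↔
      ∃ α β : R →+ ZMod 2, Independent α β ∧ P α.ker ∧ P β.ker ∧ P (α + β).ker := by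
  constructor
  · intro h
    have hne : {n : ℕ∞ | ∃ C : Set (AddSubgroup R), (∀ I ∈ C, P I ∧ I ≠ ⊤) ∧
        (⋃ I ∈ C, (I : Set R)) = Set.univ ∧ C.encard = n}.Nonempty := by
      -- With no cover the infimum would be `⊤`, not 3; otherwise it is attained.
      by_contra! hemp
      rw [coveringNumber, hemp, sInf_empty] at h
      exact absurd h (by decide)
    obtain ⟨C, hC, hU, hcard⟩ := csInf_mem hne
    rw [← coveringNumber, h] at hcard
    obtain ⟨A, B, D, hAB, hAD, hBD, rfl⟩ := Set.encard_eq_three.1 hcard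
    have hmem : ∀ x : R, x ∈ A ∨ x ∈ B ∨ x ∈ D := fun x => by
      have : x ∈ ⋃ I ∈ ({A, B, D} : Set (AddSubgroup R)), (I : Set R) := hU ▸ Set.mem_univ x
      simpa using this
    obtain ⟨hPA, hA⟩ := hC A (by simp)
    obtain ⟨hPB, hB⟩ := hC B (by simp)
    obtain ⟨hPD, hD⟩ := hC D (by simp)
    obtain ⟨α, hα⟩ := exists_character_of_index_eq_two (index_eq_two_of_cover hA hB hD hmem)
    obtain ⟨β, hβ⟩ := exists_character_of_index_eq_two
      (index_eq_two_of_cover hB hA hD fun x => by have := hmem x; tauto)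
    have hαA : α.ker = A := by ext x; exact hα x
    have hβB : β.ker = B := by ext x; exact hβ x
    have hγD : (α + β).ker = D := by
      ext x
      -- It remains to see that `D` consists of the elements in both or in neither of `A` and `B`.
      have key : ∀ s t : ZMod 2, s + t = 0 ↔ (s = 0 ↔ t = 0) := by decide
      rw [AddMonoidHom.mem_ker, AddMonoidHom.add_apply, key, hα, hβ]
      have h1 : x ∈ A → x ∈ B → x ∈ D := mem_of_mem_of_mem_of_cover hA hB hmem
      have h2 : x ∈ A → x ∈ D → x ∈ B :=
        mem_of_mem_of_mem_of_cover hA hD fun x => by have := hmem x; tauto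
      have h3 : x ∈ B → x ∈ D → x ∈ A :=
        mem_of_mem_of_mem_of_cover hB hD fun x => by have := hmem x; tauto
      have := hmem x
      tauto
    refine ⟨α, β, independent_of_ne ?_ ?_ ?_, hαA ▸ hPA, hβB ▸ hPB, hγD ▸ hPD⟩
    · rintro rfl; exact hA (hαA ▸ by ext; simp)
    · rintro rfl; exact hB (hβB ▸ by ext; simp)
    · rintro rfl; exact hAB (hαA.symm.trans hβB)
  · rintro ⟨α, β, ⟨⟨v, hv, hv'⟩, w, hw, hw'⟩, hPα, hPβ, hPγ⟩
    have hvα : v ∉ α.ker := by simp [AddMonoidHom.mem_ker, *]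
    have hvβ : v ∈ β.ker := by simp [AddMonoidHom.mem_ker, *]
    have hwα : w ∈ α.ker := by simp [AddMonoidHom.mem_ker, *]
    have hwβ : w ∉ β.ker := by simp [AddMonoidHom.mem_ker, *]
    have hvγ : v ∉ (α + β).ker := by simp [AddMonoidHom.mem_ker, *]
    have hwγ : w ∉ (α + β).ker := by simp [AddMonoidHom.mem_ker, *]
    refine le_antisymm (sInf_le ⟨{α.ker, β.ker, (α + β).ker}, ?_, ?_, ?_⟩) (le_sInf ?_)
    · rintro I (rfl | rfl | rfl)
      · exact ⟨hPα, fun h => hvα (h ▸ AddSubgroup.mem_top v)⟩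
      · exact ⟨hPβ, fun h => hwβ (h ▸ AddSubgroup.mem_top w)⟩
      · exact ⟨hPγ, fun h => hvγ (h ▸ AddSubgroup.mem_top v)⟩
    · refine Set.eq_univ_of_forall fun x => ?_
      simpa only [Set.mem_insert_iff, Set.mem_singleton_iff, Set.iUnion_iUnion_eq_or_left,
        Set.iUnion_iUnion_eq_left, Set.mem_union, SetLike.mem_coe] using
        Independent.cover (α := α) (β := β) x
    · exact Set.encard_eq_three.2 ⟨_, _, _, ne_of_mem_of_not_mem' hwα hwβ,
        ne_of_mem_of_not_mem' hwα hwγ, ne_of_mem_of_not_mem' hvβ hvγ, rfl⟩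
    · rintro n ⟨C, hC, hU, rfl⟩
      exact three_le_encard_of_cover (fun I hI => (hC I hI).2) hU

/-- If the kernels of `α`, `β` and `α + β` are left ideals, then `R` acts on `R ⧸ (ker α ⊓ ker β)`
by scalars. -/
theorem exists_scalar_of_isLeftIdeal {α β : R →+ ZMod 2} (h : Independent α β)
    (hα : IsLeftIdeal α.ker) (hβ : IsLeftIdeal β.ker) (hγ : IsLeftIdeal (α + β).ker) :
    ∃ l : R →+ ZMod 2, (∀ x y, l (x * y) = l x * l y) ∧
      (∀ x y, α (x * y) = l x * α y) ∧ ∀ x y, β (x * y) = l x * β y := by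
  obtain ⟨⟨v, hv, hv'⟩, w, hw, hw'⟩ := h
  have key : ∀ s : ZMod 2, s = 0 ∨ s = 1 := by decide
  have two : (1 : ZMod 2) + 1 = 0 := by decide
  -- `R ⧸ ker φ` has order two and is generated by the class of `u`, so `x` acts on it by the scalar
  -- `φ (x * u)`.
  have scalar : ∀ {φ : R →+ ZMod 2}, IsLeftIdeal φ.ker → ∀ {u}, φ u = 1 →
      ∀ x y, φ (x * y) = φ (x * u) * φ y := by
    intro φ hφ u hu x y
    rcases key (φ y) with h | h
    · rw [h, mul_zero]
      exact hφ x y h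
    · have : φ (x * (y - u)) = 0 :=
        hφ x (y - u) (by simp [AddMonoidHom.mem_ker, h, hu])
      rw [mul_sub, map_sub, sub_eq_zero] at this
      rw [h, mul_one, this]
  -- The third line makes the two eigenvalues agree: `v + w` lies in `ker (α + β)`, hence so does `x
  -- * (v + w)`.
  have heq : ∀ x, α (x * v) = β (x * w) := by
    intro x
    have h1 : α (x * w) = 0 := hα x w hw
    have h2 : β (x * v) = 0 := hβ x v hv'
    have h3 : α (x * (v + w)) + β (x * (v + w)) = 0 :=
      hγ x (v + w) (by simp [AddMonoidHom.mem_ker, *])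
    simp only [mul_add, map_add, h1, h2, add_zero, zero_add] at h3
    exact CharTwo.add_eq_zero.1 h3
  refine ⟨α.comp (AddMonoidHom.mulRight v), fun x y => ?_, fun x y => ?_, fun x y => ?_⟩
  · simpa [mul_assoc] using scalar hα hv x (y * v)
  · exact scalar hα hv x y
  · simpa [heq] using scalar hβ hw' x y

/-- `R` has a pair of independent characters vanishing on all products. -/
def HasNullPair (R : Type*) [NonUnitalRing R] : Prop :=
  ∃ α β : R →+ ZMod 2, Independent α β ∧ (∀ x y, α (x * y) = 0) ∧ ∀ x y, β (x * y) = 0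

/-- `R` has a multiplicative character `l` and a character `m` with `m (x * y) = l x * m y`,
independent of each other. -/
def HasLeftScalarPair (R : Type*) [NonUnitalRing R] : Prop :=
  ∃ l m : R →+ ZMod 2, Independent l m ∧ (∀ x y, l (x * y) = l x * l y) ∧
    ∀ x y, m (x * y) = l x * m y

/-- `R` has a multiplicative character `l` and a character `m` with `m (x * y) = m x * l y`,
independent of each other. -/
def HasRightScalarPair (R : Type*) [NonUnitalRing R] : Prop :=
  ∃ l m : R →+ ZMod 2, Independent l m ∧ (∀ x y, l (x * y) = l x * l y) ∧
    ∀ x y, m (x * y) = m x * l y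

theorem isLeftIdeal_ker {φ l : R →+ ZMod 2} (h : ∀ x y, φ (x * y) = l x * φ y) :
    IsLeftIdeal φ.ker := fun r x hx => by
  rw [AddMonoidHom.mem_ker] at hx ⊢
  rw [h, hx, mul_zero]

theorem Independent.ne_zero_left {α β : R →+ ZMod 2} (h : Independent α β) : α ≠ 0 := by
  rintro rfl
  obtain ⟨⟨v, hv, -⟩, -⟩ := h
  exact zero_ne_one hv

theorem Independent.symm {α β : R →+ ZMod 2} (h : Independent α β) : Independent β α :=
  ⟨h.2.imp fun _ h => h.symm, h.1.imp fun _ h => h.symm⟩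

theorem Independent.ne {α β : R →+ ZMod 2} (h : Independent α β) : α ≠ β := by
  rintro rfl
  obtain ⟨⟨v, hv, hv'⟩, -⟩ := h
  exact zero_ne_one (hv'.symm.trans hv)

theorem etaLeft_eq_three_iff : etaLeft R = 3 ↔ HasNullPair R ∨ HasLeftScalarPair R := by
  rw [etaLeft, coveringNumber_eq_three_iff]
  constructor
  · rintro ⟨α, β, h, hα, hβ, hγ⟩
    obtain ⟨l, hl, hlα, hlβ⟩ := exists_scalar_of_isLeftIdeal h hα hβ hγ
    by_cases hl0 : l = 0
    · subst hl0
      exact Or.inl ⟨α, β, h, by simpa using hlα, by simpa using hlβ⟩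
    · right
      -- As `α ≠ β`, the nonzero `l` differs from at least one of them and is independent of that
      -- one.
      by_cases hα' : l = α
      · exact ⟨l, β, independent_of_ne hl0 h.symm.ne_zero_left (hα' ▸ h.ne), hl, hlβ⟩
      · exact ⟨l, α, independent_of_ne hl0 h.ne_zero_left hα', hl, hlα⟩
  · rintro (⟨α, β, h, hα, hβ⟩ | ⟨l, m, h, hl, hm⟩)
    · exact ⟨α, β, h, isLeftIdeal_ker (l := 0) (by simpa using hα),
        isLeftIdeal_ker (l := 0) (by simpa using hβ),
        isLeftIdeal_ker (l := 0) (by simp [hα, hβ])⟩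
    · exact ⟨l, m, h, isLeftIdeal_ker hl, isLeftIdeal_ker hm,
        isLeftIdeal_ker (l := l) (by simp [hl, hm, mul_add])⟩

/-! ### Right ideals through the opposite ring -/

section Opposite

open MulOpposite

/-- An additive character of `R`, viewed as a character of the opposite ring. -/
def opCharacter : (R →+ ZMod 2) ≃ (Rᵐᵒᵖ →+ ZMod 2) where
  toFun α := α.comp (opAddEquiv (α := R)).symm.toAddMonoidHom
  invFun α := α.comp (opAddEquiv (α := R)).toAddMonoidHom
  left_inv _ := rfl
  right_inv _ := rfl

@[simp]
theorem opCharacter_apply (α : R →+ ZMod 2) (x : Rᵐᵒᵖ) : opCharacter α x = α x.unop := rfl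

theorem independent_opCharacter_iff {α β : R →+ ZMod 2} :
    Independent (opCharacter α) (opCharacter β) ↔ Independent α β := by
  simp [Independent, MulOpposite.exists]

theorem isLeftIdeal_ker_opCharacter_iff {α : R →+ ZMod 2} :
    IsLeftIdeal (opCharacter α).ker ↔ IsRightIdeal α.ker := by
  simp [IsLeftIdeal, IsRightIdeal, MulOpposite.forall, AddMonoidHom.mem_ker]

theorem etaLeft_mulOpposite_eq_three_iff : etaLeft Rᵐᵒᵖ = 3 ↔ etaRight R = 3 := by
  rw [etaLeft, etaRight, coveringNumber_eq_three_iff, coveringNumber_eq_three_iff,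
    opCharacter.surjective.exists]
  refine exists_congr fun α => ?_
  rw [opCharacter.surjective.exists]
  refine exists_congr fun β => ?_
  have : opCharacter α + opCharacter β = opCharacter (α + β) := rfl
  rw [this]
  simp only [isLeftIdeal_ker_opCharacter_iff, independent_opCharacter_iff]

theorem hasNullPair_mulOpposite_iff : HasNullPair Rᵐᵒᵖ ↔ HasNullPair R := by
  simp only [HasNullPair, opCharacter.surjective.exists, independent_opCharacter_iff,
    MulOpposite.forall, opCharacter_apply, unop_mul, unop_op]
  refine exists₂_congr fun α β => and_congr_right fun _ => ?_
  exact and_congr forall_comm forall_comm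

theorem hasLeftScalarPair_mulOpposite_iff : HasLeftScalarPair Rᵐᵒᵖ ↔ HasRightScalarPair R := by
  simp only [HasLeftScalarPair, HasRightScalarPair, opCharacter.surjective.exists,
    independent_opCharacter_iff, MulOpposite.forall, opCharacter_apply, unop_mul, unop_op]
  refine exists₂_congr fun α β => and_congr_right fun _ => ?_
  rw [forall_comm, forall_comm (p := fun x y => β (y * x) = α x * β y)]
  simp only [mul_comm (α _) (α _), mul_comm (α _) (β _)]

theorem etaRight_eq_three_iff : etaRight R = 3 ↔ HasNullPair R ∨ HasRightScalarPair R := by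
  rw [← etaLeft_mulOpposite_eq_three_iff, etaLeft_eq_three_iff, hasNullPair_mulOpposite_iff,
    hasLeftScalarPair_mulOpposite_iff]

end Opposite

/-- If `x` lies in the kernel of one of the three characters `φ`, right stability gives `l x * φ y =
φ (x * y) = 0` for all `y`, so `l x = 0` because `φ ≠ 0`. The three kernels cover `R`, so `l = 0`.
-/
theorem eta_eq_three_iff : eta R = 3 ↔ HasNullPair R := by
  rw [eta, coveringNumber_eq_three_iff]
  constructor
  · rintro ⟨α, β, h, hα, hβ, hγ⟩
    obtain ⟨l, hl, hlα, hlβ⟩ := exists_scalar_of_isLeftIdeal h hα.1 hβ.1 hγ.1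
    obtain ⟨⟨v, hv, hv'⟩, w, hw, hw'⟩ := id h
    have hl0 : ∀ x, l x = 0 := by
      have hα' : ∀ x y, α x = 0 → l x * α y = 0 := fun x y hx => (hlα x y) ▸ hα.2 y x hx
      have hβ' : ∀ x y, β x = 0 → l x * β y = 0 := fun x y hx => (hlβ x y) ▸ hβ.2 y x hx
      have hγ' : ∀ x y, α x + β x = 0 → l x * α y + l x * β y = 0 := fun x y hx => by
        rw [← hlα, ← hlβ]
        exact hγ.2 y x hx
      have key : ∀ s t : ZMod 2, s = 0 ∨ t = 0 ∨ s + t = 0 := by decide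
      intro x
      rcases key (α x) (β x) with h | h | h
      · simpa [hv] using hα' x v h
      · simpa [hw'] using hβ' x w h
      · simpa [hv, hv'] using hγ' x v h
    exact ⟨α, β, h, by simpa [hl0] using hlα, by simpa [hl0] using hlβ⟩
  · rintro ⟨α, β, h, hα, hβ⟩
    have hid : ∀ φ : R →+ ZMod 2, (∀ x y, φ (x * y) = 0) → IsTwoSidedIdeal φ.ker :=
      fun φ hφ => ⟨fun r x _ => hφ r x, fun r x _ => hφ x r⟩
    exact ⟨α, β, h, hid α hα, hid β hβ, hid _ (by simp [hα, hβ])⟩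

end Characters

/-! ### Recognising a factor ring of order four by its coordinates -/

section FactorRings

variable {R : Type*} [NonUnitalRing R]

theorem hasFactorRing_iff_exists_surjective {S : Type*} [NonUnitalRing S] :
    HasFactorRing R S ↔ ∃ f : R →ₙ+* S, Function.Surjective f := by
  constructor
  · rintro ⟨I, ⟨e⟩⟩
    refine ⟨{ toFun := fun x => e (x : I.ringCon.Quotient), map_mul' := fun x y => ?_,
              map_zero' := ?_, map_add' := fun x y => ?_ }, ?_⟩
    · rw [RingCon.coe_mul, map_mul]
    · rw [RingCon.coe_zero, map_zero]
    · rw [RingCon.coe_add, map_add]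
    · exact e.surjective.comp Quotient.mk''_surjective
  · rintro ⟨f, hf⟩
    refine ⟨TwoSidedIdeal.ker f, ⟨RingEquiv.ofBijective
      ({ toFun := Quotient.lift f fun _ _ h => h
         map_mul' := ?_, map_zero' := map_zero f, map_add' := ?_ } :
        (TwoSidedIdeal.ker f).ringCon.Quotient →ₙ+* S) ⟨?_, ?_⟩⟩⟩
    · rintro ⟨x⟩ ⟨y⟩
      exact map_mul f x y
    · rintro ⟨x⟩ ⟨y⟩
      exact map_add f x y
    · rintro ⟨x⟩ ⟨y⟩ h
      exact Quotient.sound h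
    · intro s
      obtain ⟨x, rfl⟩ := hf s
      exact ⟨(x : (TwoSidedIdeal.ker f).ringCon.Quotient), rfl⟩

/-- Two characters of `S` that separate points and are jointly onto, and whose product rules are
those of `α` and `β`, identify `S` with a factor ring of `R`. -/
theorem exists_surjective_of_characters {S : Type*} [NonUnitalRing S] {a b : S →+ ZMod 2}
    (hinj : ∀ s t, a s = a t → b s = b t → s = t) (hab : Independent a b)
    {α β : R →+ ZMod 2} (h : Independent α β) {p q : ZMod 2 → ZMod 2 → ZMod 2 → ZMod 2 → ZMod 2}
    (ha : ∀ s t, a (s * t) = p (a s) (b s) (a t) (b t))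
    (hb : ∀ s t, b (s * t) = q (a s) (b s) (a t) (b t))
    (hα : ∀ x y, α (x * y) = p (α x) (β x) (α y) (β y))
    (hβ : ∀ x y, β (x * y) = q (α x) (β x) (α y) (β y)) :
    ∃ f : R →ₙ+* S, Function.Surjective f := by
  -- `(a, b)` is a bijection from `S` to pairs, so `f x` is the only element with coordinates `(α x,
  -- β x)`; each ring law is checked on coordinates.
  choose f hfa hfb using fun x => hab.exists_eq (α x) (β x)
  refine ⟨{ toFun := f, map_mul' := fun x y => hinj _ _ ?_ ?_, map_zero' := hinj _ _ ?_ ?_,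
            map_add' := fun x y => hinj _ _ ?_ ?_ }, fun s => ?_⟩
  · rw [hfa, hα, ha, hfa, hfa, hfb, hfb]
  · rw [hfb, hβ, hb, hfa, hfa, hfb, hfb]
  · simp [hfa]
  · simp [hfb]
  · simp [hfa]
  · simp [hfb]
  · obtain ⟨x, hx, hx'⟩ := h.exists_eq (a s) (b s)
    exact ⟨x, hinj _ _ ((hfa x).trans hx) ((hfb x).trans hx')⟩

theorem Independent.comp {S : Type*} [NonUnitalRing S] {a b : S →+ ZMod 2} (h : Independent a b)
    {f : R →+ S} (hf : Function.Surjective f) : Independent (a.comp f) (b.comp f) :=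
  ⟨hf.exists.1 h.1, hf.exists.1 h.2⟩

/-- The characters of `S` pull back along a factor map, and conversely determine it. -/
theorem hasFactorRing_iff_of_characters {S : Type*} [NonUnitalRing S] {a b : S →+ ZMod 2}
    (hinj : ∀ s t, a s = a t → b s = b t → s = t) (hab : Independent a b)
    {p q : ZMod 2 → ZMod 2 → ZMod 2 → ZMod 2 → ZMod 2}
    (ha : ∀ s t, a (s * t) = p (a s) (b s) (a t) (b t))
    (hb : ∀ s t, b (s * t) = q (a s) (b s) (a t) (b t)) :
    HasFactorRing R S ↔ ∃ α β : R →+ ZMod 2, Independent α β ∧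
      (∀ x y, α (x * y) = p (α x) (β x) (α y) (β y)) ∧
      ∀ x y, β (x * y) = q (α x) (β x) (α y) (β y) := by
  rw [hasFactorRing_iff_exists_surjective]
  constructor
  · rintro ⟨f, hf⟩
    refine ⟨a.comp (f : R →+ S), b.comp (f : R →+ S), hab.comp hf, fun x y => ?_, fun x y => ?_⟩
    · simp [ha]
    · simp [hb]
  · rintro ⟨α, β, h, hα, hβ⟩
    exact exists_surjective_of_characters hinj hab h ha hb hα hβ

/-! ### Coordinates on the three matrix rings -/

/-- The `(i, j)` entry, as a character of a subring of `2 × 2` matrices over `ℤ/2`. -/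
def entryCharacter (S : NonUnitalSubring (Matrix (Fin 2) (Fin 2) (ZMod 2))) (i j : Fin 2) :
    S →+ ZMod 2 where
  toFun M := M.1 i j
  map_zero' := rfl
  map_add' _ _ := rfl

@[simp]
theorem entryCharacter_apply (S : NonUnitalSubring (Matrix (Fin 2) (Fin 2) (ZMod 2)))
    (i j : Fin 2) (M : S) : entryCharacter S i j M = M.1 i j := rfl

theorem mem_ringX_iff {M : Matrix (Fin 2) (Fin 2) (ZMod 4)} : M ∈ ringX ↔
    M = !![0, 0; 0, 0] ∨ M = !![2, 0; 0, 0] ∨ M = !![0, 0; 0, 2] ∨ M = !![2, 0; 0, 2] := Iff.rfl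

theorem mem_ringY_iff {M : Matrix (Fin 2) (Fin 2) (ZMod 2)} : M ∈ ringY ↔
    M = !![0, 0; 0, 0] ∨ M = !![1, 0; 0, 0] ∨ M = !![0, 1; 0, 0] ∨ M = !![1, 1; 0, 0] := Iff.rfl

theorem mem_ringZ_iff {M : Matrix (Fin 2) (Fin 2) (ZMod 2)} : M ∈ ringZ ↔
    M = !![0, 0; 0, 0] ∨ M = !![0, 1; 0, 0] ∨ M = !![0, 0; 0, 1] ∨ M = !![0, 1; 0, 1] := Iff.rfl

theorem ringX_diag (M : ringX) (i : Fin 2) : M.1 i i = 0 ∨ M.1 i i = 2 := by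
  obtain ⟨M, hM⟩ := M
  rw [mem_ringX_iff] at hM
  rcases hM with rfl | rfl | rfl | rfl <;> fin_cases i <;> simp

theorem ringX_offDiag (M : ringX) {i j : Fin 2} (hij : i ≠ j) : M.1 i j = 0 := by
  obtain ⟨M, hM⟩ := M
  rw [mem_ringX_iff] at hM
  rcases hM with rfl | rfl | rfl | rfl <;> fin_cases i <;> fin_cases j <;> simp at hij ⊢

/-- All entries are 0 or 2, and `2 * 2 = 0` in `ZMod 4`. -/
theorem ringX_mul (M N : ringX) : M * N = 0 := by
  have key : ∀ s t : ZMod 4, s = 0 ∨ s = 2 → t = 0 ∨ t = 2 → s * t = 0 := by decide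
  ext i j
  have entry : ∀ (M : ringX) (i j : Fin 2), M.1 i j = 0 ∨ M.1 i j = 2 := fun M i j => by
    rcases eq_or_ne i j with rfl | hij
    · exact ringX_diag M i
    · exact Or.inl (ringX_offDiag M hij)
  simp [Matrix.mul_apply, key _ _ (entry M _ _) (entry N _ _)]

/-- Half of the `i`-th diagonal entry, as a character of `ringX`. -/
def halfDiag (i : Fin 2) : ringX →+ ZMod 2 where
  toFun M := if M.1 i i = 0 then 0 else 1
  map_zero' := by simp
  map_add' M N := by
    have key : ∀ s t : ZMod 4, s = 0 ∨ s = 2 → t = 0 ∨ t = 2 →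
        (if s + t = 0 then 0 else 1 : ZMod 2) =
          (if s = 0 then 0 else 1) + if t = 0 then 0 else 1 := by decide
    exact key _ _ (ringX_diag M i) (ringX_diag N i)

theorem halfDiag_injective {i : Fin 2} {M N : ringX} (h : halfDiag i M = halfDiag i N) :
    M.1 i i = N.1 i i := by
  have key : ∀ s t : ZMod 4, s = 0 ∨ s = 2 → t = 0 ∨ t = 2 →
      (if s = 0 then 0 else 1 : ZMod 2) = (if t = 0 then 0 else 1) → s = t := by decide
  exact key _ _ (ringX_diag M i) (ringX_diag N i) h

theorem hasFactorRing_ringX_iff : HasFactorRing R ringX ↔ HasNullPair R := by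
  refine hasFactorRing_iff_of_characters (a := halfDiag 0) (b := halfDiag 1)
    (p := fun _ _ _ _ => 0) (q := fun _ _ _ _ => 0) ?_ ?_ ?_ ?_
  · intro M N h h'
    ext i j
    rcases eq_or_ne i j with rfl | hij
    · fin_cases i
      · exact halfDiag_injective h
      · exact halfDiag_injective h'
    · rw [ringX_offDiag M hij, ringX_offDiag N hij]
  · exact ⟨⟨⟨_, mem_ringX_iff.2 (Or.inr (Or.inl rfl))⟩, rfl, rfl⟩,
      ⟨_, mem_ringX_iff.2 (Or.inr (Or.inr (Or.inl rfl)))⟩, rfl, rfl⟩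
  · simp [ringX_mul]
  · simp [ringX_mul]

theorem ringY_row_one (M : ringY) (j : Fin 2) : M.1 1 j = 0 := by
  obtain ⟨M, hM⟩ := M
  rw [mem_ringY_iff] at hM
  rcases hM with rfl | rfl | rfl | rfl <;> fin_cases j <;> rfl

theorem hasFactorRing_ringY_iff : HasFactorRing R ringY ↔ HasLeftScalarPair R := by
  -- With top row `(s, t)`, the product rule is `(s, t) * (s', t') = (s * s', s * t')`.
  refine hasFactorRing_iff_of_characters (a := entryCharacter ringY 0 0)
    (b := entryCharacter ringY 0 1) (p := fun s _ s' _ => s * s') (q := fun s _ _ t' => s * t')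
    ?_ ?_ ?_ ?_
  · intro M N h h'
    ext i j
    fin_cases i <;> fin_cases j <;> simp_all [ringY_row_one]
  · exact ⟨⟨⟨_, mem_ringY_iff.2 (Or.inr (Or.inl rfl))⟩, rfl, rfl⟩,
      ⟨_, mem_ringY_iff.2 (Or.inr (Or.inr (Or.inl rfl)))⟩, rfl, rfl⟩
  · simp [Matrix.mul_apply, ringY_row_one]
  · simp [Matrix.mul_apply, ringY_row_one]

theorem ringZ_col_zero (M : ringZ) (i : Fin 2) : M.1 i 0 = 0 := by
  obtain ⟨M, hM⟩ := M
  rw [mem_ringZ_iff] at hM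
  rcases hM with rfl | rfl | rfl | rfl <;> fin_cases i <;> rfl

theorem hasFactorRing_ringZ_iff : HasFactorRing R ringZ ↔ HasRightScalarPair R := by
  -- The multiplicative character is now the lower right entry `s`; with upper right entry `t`, `(s,
  -- t) * (s', t') = (s * s', t * s')`.
  refine hasFactorRing_iff_of_characters (a := entryCharacter ringZ 1 1)
    (b := entryCharacter ringZ 0 1) (p := fun s _ s' _ => s * s') (q := fun _ t s' _ => t * s')
    ?_ ?_ ?_ ?_
  · intro M N h h'
    ext i j
    fin_cases i <;> fin_cases j <;> simp_all [ringZ_col_zero]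
  · exact ⟨⟨⟨_, mem_ringZ_iff.2 (Or.inr (Or.inr (Or.inl rfl)))⟩, rfl, rfl⟩,
      ⟨_, mem_ringZ_iff.2 (Or.inr (Or.inl rfl))⟩, rfl, rfl⟩
  · simp [Matrix.mul_apply, ringZ_col_zero]
  · simp [Matrix.mul_apply, ringZ_col_zero]

end FactorRings

end IdealCover

theorem corollary2 (R : Type*) [NonUnitalRing R] :
    (IdealCover.eta R = 3 ↔ IdealCover.HasFactorRing R IdealCover.ringX) ∧
    (IdealCover.etaLeft R = 3 ↔
      IdealCover.HasFactorRing R IdealCover.ringX ∨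
        IdealCover.HasFactorRing R IdealCover.ringY) ∧
    (IdealCover.etaRight R = 3 ↔
      IdealCover.HasFactorRing R IdealCover.ringX ∨
        IdealCover.HasFactorRing R IdealCover.ringZ) := by
  rw [IdealCover.hasFactorRing_ringX_iff, IdealCover.hasFactorRing_ringY_iff,
    IdealCover.hasFactorRing_ringZ_iff]
  exact ⟨IdealCover.eta_eq_three_iff, IdealCover.etaLeft_eq_three_iff,
    IdealCover.etaRight_eq_three_iff⟩
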